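/- Let $d,b\ge 1$ be integers, let $z$ be a random data point with law $P$ on a measurable space $\mathcal Z$, and let $f:\mathbb R^d\times\mathcal Z\to\mathbb R$ be such that $f(\cdot,z)$ is $L$-Lipschitz (with respect to the Euclidean norm) for every $z\in\mathcal Z$ and $f(x,\cdot)$ is $P$-integrable for every $x\in\mathbb R^d$. Put $F(x)=\mathbb E_{z\sim P}[f(x,z)]$ and, for $\delta>0$, let $\hat F_\delta(x)=\mathbb E_v[F(x+\delta v)]$ with $v$ uniformly distributed on the unit ball of $\mathbb R^d$. For $x,y\in\mathbb R^d$, data points $z_{1:b}=(z_1,\dots,z_b)\in\mathcal Z^b$, and i.i.d. directions $u_{ij}$ ($1\le i\le b$, $1\le j\le d$) uniformly distributed on the unit sphere of $\mathbb R^d$, let $$\mathrm{Diff}_{f,\delta}(x,y,z_{1:b})=\frac1b\sum_{i=1}^b\frac1d\sum_{j=1}^d\frac d\delta\bigl(f(x+\delta u_{ij},z_i)-f(y+\delta u_{ij},z_i)\bigr)u_{ij}.$$ Then $\hat F_\delta$ is differentiable and, for all $x,y\in\mathbb R^d$: (1) (Unbiasedness and variance.) If $z_1,\dots,z_b$ are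 i.i.d. with law $P$ and independent of the $u_{ij}$, then, with expectation over both the data points and the directions, $\mathrm{Diff}_{f,\delta}(x,y,z_{1:b})$ is square-integrable, $$\mathbb E\bigl[\mathrm{Diff}_{f,\delta}(x,y,z_{1:b})\bigr]=\nabla\hat F_\delta(x)-\nabla\hat F_\delta(y),$$ $$\mathbb E\bigl\|\mathrm{Diff}_{f,\delta}(x,y,z_{1:b})-[\nabla\hat F_\delta(x)-\nabla\hat F_\delta(y)]\bigr\|^2\le\frac{16dL^2}{b\delta^2}\|x-y\|^2.$$ (2) (Sensitivity.) For every realization of the directions $u_{ij}$ and all batches $z_{1:b},z'_{1:b}\in\mathcal Z^b$ that differ in at most one data point, with the same directions used for both, $$\bigl\|\mathrm{Diff}_{f,\delta}(x,y,z_{1:b})-\mathrm{Diff}_{f,\delta}(x,y,z'_{1:b})\bigr\|\le\frac{2dL}{b\delta}\|x-y\|.$$ -/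

import Mathlib

open MeasureTheory
open scoped NNReal

noncomputable section

/-- The uniform probability distribution on the unit ball of `ℝ^d`. -/
def uniformBall (d : ℕ) : Measure (EuclideanSpace ℝ (Fin d)) :=
  ProbabilityTheory.cond volume (Metric.closedBall 0 1)

/-- The uniform probability distribution on the unit sphere of `ℝ^d`:
the normalized surface measure. -/
def uniformSphere (d : ℕ) : Measure (Metric.sphere (0 : EuclideanSpace ℝ (Fin d)) 1) :=
  ProbabilityTheory.cond (volume : Measure (EuclideanSpace ℝ (Fin d))).toSphere Set.univ

/-- The uniform smoothing `x ↦ E_v [h (x + δ v)]`, with `v` uniform on the unit ball. -/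
def uniformSmoothing {d : ℕ} (δ : ℝ) (h : EuclideanSpace ℝ (Fin d) → ℝ)
    (x : EuclideanSpace ℝ (Fin d)) : ℝ :=
  ∫ v, h (x + δ • v) ∂(uniformBall d)

/-- The objective `F x = E_z [f (x, z)]`, with `z` distributed according to `P`. -/
def objective {d : ℕ} {𝒵 : Type*} [MeasurableSpace 𝒵] (P : Measure 𝒵)
    (f : EuclideanSpace ℝ (Fin d) → 𝒵 → ℝ) (x : EuclideanSpace ℝ (Fin d)) : ℝ :=
  ∫ z, f x z ∂P

/-- The zeroth-order estimator of the gradient difference between `x` and `y`, as a function of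
the data points `z i` and of the directions `u i j` (`d` directions for each data point):
`(1/b) ∑ i, (1/d) ∑ j, (d/δ) (f (x + δ u i j, z i) - f (y + δ u i j, z i)) u i j`. -/
def diffEstimator {d b : ℕ} {𝒵 : Type*} (f : EuclideanSpace ℝ (Fin d) → 𝒵 → ℝ) (δ : ℝ)
    (x y : EuclideanSpace ℝ (Fin d)) (z : Fin b → 𝒵)
    (u : Fin b → Fin d → Metric.sphere (0 : EuclideanSpace ℝ (Fin d)) 1) :
    EuclideanSpace ℝ (Fin d) :=
  (1 / (b : ℝ)) • ∑ i, (1 / (d : ℝ)) • ∑ j,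
    ((d : ℝ) / δ *
        (f (x + δ • (u i j : EuclideanSpace ℝ (Fin d))) (z i)
          - f (y + δ • (u i j : EuclideanSpace ℝ (Fin d))) (z i))) •
      (u i j : EuclideanSpace ℝ (Fin d))

/-- The joint law of the randomness of the estimator: `z i` i.i.d. with law `P`, `u i j` i.i.d.
uniform on the unit sphere, and the two families independent of each other. -/
def estimatorLaw (d b : ℕ) {𝒵 : Type*} [MeasurableSpace 𝒵] (P : Measure 𝒵) :
    Measure ((Fin b → 𝒵) × (Fin b → Fin d → Metric.sphere (0 : EuclideanSpace ℝ (Fin d)) 1)) :=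
  (Measure.pi fun _ => P).prod (Measure.pi fun _ => Measure.pi fun _ => uniformSphere d)

/-- Two batches are neighboring if they agree except possibly at one data point. -/
def Neighboring {b : ℕ} {𝒵 : Type*} (z z' : Fin b → 𝒵) : Prop :=
  ∃ k, ∀ i, i ≠ k → z i = z' i

end

/-! The gradient of the smoothing is a surface average, `∇F̂(x) = (d/δ) E_u[F(x + δu) u]`. For a
merely continuous `F` this follows by moving the ball instead of the function: in polar coordinates
only the upper limit of the radial integral depends on the centre, so no derivative falls on `F`
(`hasFDerivAt_setIntegral_closedBall`, `hasGradientAt_uniformSmoothing`). Unbiasedness is then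
Fubini.

Since `x` and `y` share each direction, every coefficient of the estimator is at most `K = dL‖x -
y‖/δ` in absolute value. Each data point contributes a block averaging `d` directions. Given the
data point, the second moment of the block is its variance, at most `K²/d`, plus the squared norm of
its mean. The latter is also at most `K²/d`, because `E⟪w,u⟫² = ‖w‖²/d`
(`norm_sq_integral_smul_uniformSphere_le`). Averaging `b` independent blocks gives `2K²/(bd) =
2dL²‖x - y‖²/(bδ²)`, within the required bound.

For sensitivity, only one block changes, and both its values have norm at most `K`. Joint
measurability of `f` is not assumed, so the moments are computed for a jointly measurable version
(`exists_measurable_uncurry_ae_eq`). -/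

/-! ### Differentiating an integral over a moving ball. -/

section BallDerivative

open Metric Set

variable {E : Type*} [NormedAddCommGroup E] [InnerProductSpace ℝ E]

/-- The distance from the origin to the boundary of the unit ball around `w`, in the direction of
the unit vector `u`. -/
noncomputable def boundaryRadius (w u : E) : ℝ :=
  inner ℝ u w + √(inner ℝ u w ^ 2 + 1 - ‖w‖ ^ 2)

theorem boundaryRadius_zero (u : E) : boundaryRadius 0 u = 1 := by
  simp [boundaryRadius]

theorem continuous_boundaryRadius (w : E) : Continuous (boundaryRadius w) := by
  unfold boundaryRadius
  fun_prop

theorem norm_smul_sub_sq {u : E} (hu : ‖u‖ = 1) (w : E) (r : ℝ) :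
    ‖r • u - w‖ ^ 2 = (r - inner ℝ u w) ^ 2 + ‖w‖ ^ 2 - inner ℝ u w ^ 2 := by
  rw [norm_sub_sq_real, norm_smul, hu, inner_smul_left, mul_one, Real.norm_eq_abs, sq_abs]
  simp only [conj_trivial]
  ring

/-- Membership is a quadratic inequality in `r`. As `w` is interior to the unit ball, the smaller
root is negative, so for `r > 0` only the larger root matters. -/
theorem smul_mem_closedBall_iff {u w : E} (hu : ‖u‖ = 1) (hw : ‖w‖ < 1) {r : ℝ} (hr : 0 < r) :
    r • u ∈ closedBall w 1 ↔ r ≤ boundaryRadius w u := by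
  have hw2 : ‖w‖ ^ 2 < 1 := by nlinarith [norm_nonneg w]
  have hlt : |inner ℝ u w| < √(inner ℝ u w ^ 2 + 1 - ‖w‖ ^ 2) :=
    Real.lt_sqrt_of_sq_lt (by rw [sq_abs]; linarith)
  rw [mem_closedBall_iff_norm, ← sq_le_one_iff₀ (norm_nonneg _), norm_smul_sub_sq hu,
    show (r - inner ℝ u w) ^ 2 + ‖w‖ ^ 2 - inner ℝ u w ^ 2 ≤ 1 ↔
      (r - inner ℝ u w) ^ 2 ≤ inner ℝ u w ^ 2 + 1 - ‖w‖ ^ 2 by constructor <;> intro h <;> linarith,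
    ← sq_abs (r - _), ← Real.le_sqrt (abs_nonneg _), abs_le, boundaryRadius]
  swap
  · nlinarith [sq_nonneg (inner ℝ u w)]
  constructor
  · rintro ⟨-, h⟩
    linarith
  · intro h
    exact ⟨by linarith [le_abs_self (inner ℝ u w)], by linarith⟩

/-- The boundary point lies at distance 1 from `w`, so its distance from the origin differs from 1
by at most `‖w‖`: the reverse triangle inequality. -/
theorem abs_boundaryRadius_sub_one_le {u w : E} (hu : ‖u‖ = 1) (hw : ‖w‖ < 1) :
    |boundaryRadius w u - 1| ≤ ‖w‖ := by
  have hw2 : ‖w‖ ^ 2 < 1 := by nlinarith [norm_nonneg w]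
  have hD : 0 ≤ inner ℝ u w ^ 2 + 1 - ‖w‖ ^ 2 := by nlinarith [sq_nonneg (inner ℝ u w)]
  have hlt : |inner ℝ u w| ≤ √(inner ℝ u w ^ 2 + 1 - ‖w‖ ^ 2) :=
    Real.le_sqrt_of_sq_le (by rw [sq_abs]; linarith)
  have hpos : 0 ≤ boundaryRadius w u := by
    rw [boundaryRadius]; linarith [neg_abs_le (inner ℝ u w)]
  have h1 : ‖boundaryRadius w u • u - w‖ = 1 := by
    rw [← sq_eq_sq₀ (norm_nonneg _) zero_le_one, norm_smul_sub_sq hu, boundaryRadius,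
      add_sub_cancel_left, Real.sq_sqrt hD]
    ring
  have h2 := abs_norm_sub_norm_le (boundaryRadius w u • u) (boundaryRadius w u • u - w)
  rwa [h1, sub_sub_cancel, norm_smul, hu, mul_one, Real.norm_eq_abs, abs_of_nonneg hpos] at h2

/-- Both squares under the root have zero derivative at `w = 0`, so only the linear term survives.
-/
theorem hasFDerivAt_boundaryRadius (u : E) :
    HasFDerivAt (fun w => boundaryRadius w u) (innerSL ℝ u) 0 := by
  have h1 : HasFDerivAt (fun w : E => inner ℝ u w) (innerSL ℝ u) 0 :=
    (innerSL ℝ u).hasFDerivAt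
  have h2 : HasFDerivAt (fun w : E => ‖w‖ ^ 2) (2 • (innerSL ℝ (0 : E))) 0 :=
    (hasStrictFDerivAt_norm_sq (0 : E)).hasFDerivAt
  have h3 := h1.add ((((h1.pow 2).add_const 1).sub h2).sqrt (by simp))
  refine h3.congr_fderiv ?_
  ext v
  simp

variable [MeasurableSpace E] [BorelSpace E] [FiniteDimensional ℝ E] [Nontrivial E]
  (μ : Measure E) [μ.IsAddHaarMeasure]

/-- Integration in polar coordinates. -/
theorem integral_eq_integral_toSphere {g : E → ℝ} (hg : Integrable g μ) :
    ∫ x, g x ∂μ = ∫ u : sphere (0 : E) 1,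
      (∫ r in Ioi (0 : ℝ), r ^ (Module.finrank ℝ E - 1) * g (r • (u : E))) ∂μ.toSphere := by
  have hmp := μ.measurePreserving_homeomorphUnitSphereProd
  have hemb := (homeomorphUnitSphereProd E).measurableEmbedding
  have hk (x : ({(0)}ᶜ : Set E)) :
      ((homeomorphUnitSphereProd E x).2 : ℝ) • ((homeomorphUnitSphereProd E x).1 : E) = x := by
    have hx : ‖(x : E)‖ ≠ 0 := norm_ne_zero_iff.2 x.2
    simp [smul_smul, hx]
  set G : sphere (0 : E) 1 × Ioi (0 : ℝ) → ℝ := fun p => g ((p.2 : ℝ) • (p.1 : E)) with hG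
  have hcomp : G ∘ homeomorphUnitSphereProd E = fun x : ({(0)}ᶜ : Set E) => g x := by
    ext x
    simp only [hG, Function.comp_apply, hk]
  have hGint : Integrable G (μ.toSphere.prod (.volumeIoiPow (Module.finrank ℝ E - 1))) := by
    rw [← hmp.integrable_comp_emb hemb, hcomp]
    have : IntegrableOn g ({0}ᶜ) μ := hg.integrableOn
    rwa [integrableOn_iff_comap_subtypeVal (measurableSet_singleton _).compl] at this
  calc ∫ x, g x ∂μ = ∫ x : ({(0)}ᶜ : Set E), g x ∂(μ.comap (↑)) := by
        rw [integral_subtype_comap (measurableSet_singleton _).compl g, restrict_compl_singleton]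
    _ = ∫ p, G p ∂μ.toSphere.prod (.volumeIoiPow (Module.finrank ℝ E - 1)) := by
        rw [← hmp.integral_comp hemb]
        exact integral_congr_ae (.of_forall fun x => (congrFun hcomp x).symm)
    _ = ∫ u, (∫ r, G (u, r) ∂.volumeIoiPow (Module.finrank ℝ E - 1)) ∂μ.toSphere :=
        integral_prod _ hGint
    _ = _ := by
        refine integral_congr_ae (.of_forall fun u => ?_)
        simp only [Measure.volumeIoiPow, ENNReal.ofReal]
        rw [integral_withDensity_eq_integral_smul,
          integral_subtype_comap measurableSet_Ioi
            fun a : ℝ => Real.toNNReal (a ^ (Module.finrank ℝ E - 1)) • g (a • (u : E)),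
          setIntegral_congr_fun measurableSet_Ioi fun x hx => ?_]
        · rw [NNReal.smul_def, Real.coe_toNNReal _ (pow_nonneg (le_of_lt hx) _), smul_eq_mul]
        · exact (measurable_subtype_coe.pow_const _).real_toNNReal

theorem setIntegral_closedBall_eq_integral_toSphere {h : E → ℝ} (hh : Continuous h) {w : E}
    (hw : ‖w‖ < 1) :
    ∫ v in closedBall w 1, h v ∂μ = ∫ u : sphere (0 : E) 1,
      (∫ r in (0 : ℝ)..boundaryRadius w (u : E),
        r ^ (Module.finrank ℝ E - 1) * h (r • (u : E))) ∂μ.toSphere := by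
  have hint : Integrable ((closedBall w 1).indicator h) μ :=
    (hh.continuousOn.integrableOn_compact (isCompact_closedBall w 1)).integrable_indicator
      measurableSet_closedBall
  rw [← integral_indicator measurableSet_closedBall, integral_eq_integral_toSphere μ hint]
  refine integral_congr_ae (.of_forall fun u => ?_)
  have hu : ‖(u : E)‖ = 1 := norm_eq_of_mem_sphere u
  have hpos : 0 ≤ boundaryRadius w (u : E) := by
    have := abs_le.1 (abs_boundaryRadius_sub_one_le hu hw)
    linarith
  simp only
  rw [intervalIntegral.integral_of_le hpos, ← Ioi_inter_Iic,
    ← setIntegral_indicator measurableSet_Iic]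
  refine setIntegral_congr_fun measurableSet_Ioi fun r hr => ?_
  by_cases hru : r ≤ boundaryRadius w (u : E)
  · simp [indicator, hru, (smul_mem_closedBall_iff hu hw hr).2 hru]
  · have h' := mt (smul_mem_closedBall_iff hu hw hr).1 hru
    simp only [indicator, mem_Iic, hru, h', if_false, mul_zero]

/-- The derivative of the integral of a continuous function over a moving unit ball, as an
integral over the unit sphere. -/
theorem hasFDerivAt_setIntegral_closedBall {h : E → ℝ} (hh : Continuous h) :
    HasFDerivAt (fun w => ∫ v in closedBall w 1, h v ∂μ)
      (∫ u : sphere (0 : E) 1, h u • innerSL ℝ (u : E) ∂μ.toSphere) 0 := by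
  set k : sphere (0 : E) 1 → ℝ → ℝ := fun u r => r ^ (Module.finrank ℝ E - 1) * h (r • (u : E))
    with hk_def
  have hk : Continuous (Function.uncurry k) := by
    simp only [hk_def, Function.uncurry_def]
    fun_prop
  have hG (w : E) : Continuous fun u : sphere (0 : E) 1 =>
      ∫ r in (0 : ℝ)..boundaryRadius w (u : E), k u r :=
    intervalIntegral.continuous_parametric_intervalIntegral_of_continuous hk
      ((continuous_boundaryRadius w).comp continuous_subtype_val)
  -- For `‖w‖ < 1` the boundary radius lies in `[0, 2]`, so a bound of `k` on this compact set is a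
  -- Lipschitz bound uniform in `u`.
  obtain ⟨C, hC⟩ := (isCompact_univ (X := sphere (0 : E) 1)).prod
    (isCompact_Icc (a := (0 : ℝ)) (b := 2)) |>.exists_bound_of_continuousOn hk.continuousOn
  have hloc : ball (0 : E) 1 ∈ nhds (0 : E) := ball_mem_nhds _ one_pos
  have key := (hasFDerivAt_integral_of_dominated_loc_of_lip' (μ := μ.toSphere)
    (F := fun w u => ∫ r in (0 : ℝ)..boundaryRadius w (u : E), k u r)
    (F' := fun u => h u • innerSL ℝ (u : E)) (x₀ := 0) (bound := fun _ => C) hloc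
    (fun w _ => (hG w).aestronglyMeasurable)
    ((hG 0).integrable_of_hasCompactSupport (HasCompactSupport.of_compactSpace _))
    (Continuous.aestronglyMeasurable (by fun_prop))
    (.of_forall fun u w hw => ?_) (integrable_const _) (.of_forall fun u => ?_)).2
  · refine key.congr_of_eventuallyEq ?_
    filter_upwards [hloc] with w hw
    exact setIntegral_closedBall_eq_integral_toSphere μ hh (by simpa using hw)
  · have hu : ‖(u : E)‖ = 1 := norm_eq_of_mem_sphere u
    have hw1 : ‖w‖ < 1 := by simpa using hw
    have hku : Continuous (k u) := hk.comp (by fun_prop : Continuous fun r : ℝ => (u, r))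
    have hr := abs_boundaryRadius_sub_one_le hu hw1
    rw [intervalIntegral.integral_interval_sub_left (hku.intervalIntegrable _ _)
      (hku.intervalIntegrable _ _), boundaryRadius_zero, sub_zero]
    have hb : ∀ r ∈ uIoc 1 (boundaryRadius w (u : E)), ‖k u r‖ ≤ C := fun r hr' => by
      refine hC (u, r) ⟨mem_univ _, ?_⟩
      have h1 := abs_le.1 hr
      rcases mem_uIoc.1 hr' with h2 | h2 <;> constructor <;> linarith [h2.1, h2.2]
    refine (intervalIntegral.norm_integral_le_of_norm_le_const hb).trans ?_
    have hC0 : 0 ≤ C := (norm_nonneg _).trans (hC (u, 0) ⟨mem_univ _, by norm_num, by norm_num⟩)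
    gcongr
  · have hku : Continuous (k u) := hk.comp (by fun_prop : Continuous fun r : ℝ => (u, r))
    -- Fundamental theorem of calculus at radius 1, where the weight `r ^ (finrank - 1)` equals 1.
    have h1 : HasDerivAt (fun t => ∫ r in (0 : ℝ)..t, k u r) (h u) (boundaryRadius 0 (u : E)) := by
      have := intervalIntegral.integral_hasDerivAt_right (hku.intervalIntegrable 0 1)
        (hku.stronglyMeasurableAtFilter _ _) hku.continuousAt
      rw [boundaryRadius_zero]
      simpa [hk_def] using this
    exact h1.comp_hasFDerivAt (0 : E) (hasFDerivAt_boundaryRadius (u : E))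

end BallDerivative

/-! ### The smoothed gradient and second moments on the sphere. -/

section UniformSphere

open Metric Set

theorem nontrivial_euclideanSpace {d : ℕ} (hd : 0 < d) : Nontrivial (EuclideanSpace ℝ (Fin d)) :=
  Module.nontrivial_of_finrank_pos (R := ℝ) (by simpa using hd)

theorem isProbabilityMeasure_uniformSphere {d : ℕ} (hd : 0 < d) :
    IsProbabilityMeasure (uniformSphere d) := by
  have := nontrivial_euclideanSpace hd
  exact ProbabilityTheory.cond_isProbabilityMeasure
    (Measure.measure_univ_ne_zero.2
      (Measure.toSphere_ne_zero (volume : Measure (EuclideanSpace ℝ (Fin d)))))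

theorem integral_uniformSphere {d : ℕ} {G : Type*} [NormedAddCommGroup G] [NormedSpace ℝ G]
    (g : sphere (0 : EuclideanSpace ℝ (Fin d)) 1 → G) :
    ∫ u, g u ∂uniformSphere d =
      (d * (volume : Measure (EuclideanSpace ℝ (Fin d))).real (closedBall 0 1))⁻¹ •
        ∫ u, g u ∂(volume : Measure (EuclideanSpace ℝ (Fin d))).toSphere := by
  rw [uniformSphere, ProbabilityTheory.cond, Measure.restrict_univ, integral_smul_measure,
    ENNReal.toReal_inv, ← Measure.real, Measure.toSphere_real_apply_univ, finrank_euclideanSpace_fin,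
    measureReal_def, measureReal_def, Measure.addHaar_unitClosedBall_eq_addHaar_unitBall]

/-- Translation invariance moves the dependence on `y` from the integrand to the domain. -/
theorem uniformSmoothing_eq {d : ℕ} {δ : ℝ} (hδ : 0 < δ) (h : EuclideanSpace ℝ (Fin d) → ℝ)
    (x y : EuclideanSpace ℝ (Fin d)) :
    uniformSmoothing δ h y = ((volume : Measure (EuclideanSpace ℝ (Fin d))).real (closedBall 0 1))⁻¹ *
      ∫ v in closedBall (δ⁻¹ • (y - x)) 1, h (x + δ • v) := by
  rw [uniformSmoothing, uniformBall, ProbabilityTheory.cond, integral_smul_measure,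
    ENNReal.toReal_inv, ← Measure.real, smul_eq_mul]
  congr 1
  rw [← integral_indicator measurableSet_closedBall, ← integral_indicator measurableSet_closedBall,
    ← integral_add_right_eq_self ((closedBall (δ⁻¹ • (y - x)) 1).indicator fun v => h (x + δ • v))
      (δ⁻¹ • (y - x))]
  refine integral_congr_ae (.of_forall fun v => ?_)
  have h1 : x + δ • (v + δ⁻¹ • (y - x)) = y + δ • v := by
    rw [smul_add, smul_inv_smul₀ hδ.ne']
    abel
  simp only [indicator, h1, mem_closedBall_iff_norm, add_sub_cancel_right, sub_zero]

/-- The gradient of the uniform smoothing of a continuous function, as an expectation over the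
unit sphere. -/
theorem hasGradientAt_uniformSmoothing {d : ℕ} (hd : 0 < d) {δ : ℝ} (hδ : 0 < δ)
    {h : EuclideanSpace ℝ (Fin d) → ℝ} (hh : Continuous h) (x : EuclideanSpace ℝ (Fin d)) :
    HasGradientAt (uniformSmoothing δ h)
      (((d : ℝ) / δ) • ∫ u : sphere (0 : EuclideanSpace ℝ (Fin d)) 1,
        h (x + δ • (u : EuclideanSpace ℝ (Fin d))) • (u : EuclideanSpace ℝ (Fin d))
          ∂uniformSphere d) x := by
  have := nontrivial_euclideanSpace hd
  rw [hasGradientAt_iff_hasFDerivAt, funext (uniformSmoothing_eq hδ h x)]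
  have h1 := hasFDerivAt_setIntegral_closedBall
    (volume : Measure (EuclideanSpace ℝ (Fin d))) (h := fun v => h (x + δ • v)) (by fun_prop)
  have h2 : HasFDerivAt (fun y => δ⁻¹ • (y - x))
      (δ⁻¹ • ContinuousLinearMap.id ℝ (EuclideanSpace ℝ (Fin d))) x :=
    ((hasFDerivAt_id x).sub_const x).const_smul δ⁻¹
  have h3 := (HasFDerivAt.comp (g := fun w => ∫ v in closedBall w 1, h (x + δ • v)) x
    (by simpa using h1) h2).const_mul
      (((volume : Measure (EuclideanSpace ℝ (Fin d))).real (closedBall 0 1))⁻¹)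
  refine h3.congr_fderiv ?_
  have hint : Integrable (fun u : sphere (0 : EuclideanSpace ℝ (Fin d)) 1 =>
      h (x + δ • (u : EuclideanSpace ℝ (Fin d))) • (u : EuclideanSpace ℝ (Fin d)))
      (volume : Measure (EuclideanSpace ℝ (Fin d))).toSphere :=
    Continuous.integrable_of_hasCompactSupport (by fun_prop) (HasCompactSupport.of_compactSpace _)
  have h4 := (innerSL ℝ (E := EuclideanSpace ℝ (Fin d))).integral_comp_comm hint
  simp only [map_smul] at h4
  rw [h4, integral_uniformSphere]
  ext v
  have hd' : (d : ℝ) ≠ 0 := by positivity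
  simp
  field_simp
  rfl

/-- Smoothing the linear function `⟪w, ·⟫` leaves its gradient `w` unchanged, so the gradient
formula reads `w = d E[⟪w,u⟫ u]`; pairing with `w` gives the claim. -/
theorem integral_inner_sq_uniformSphere {d : ℕ} (hd : 0 < d) (w : EuclideanSpace ℝ (Fin d)) :
    ∫ u : sphere (0 : EuclideanSpace ℝ (Fin d)) 1,
      inner ℝ w (u : EuclideanSpace ℝ (Fin d)) ^ 2 ∂uniformSphere d = ‖w‖ ^ 2 / d := by
  have := isProbabilityMeasure_uniformSphere hd
  have : IsProbabilityMeasure (uniformBall d) :=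
    ProbabilityTheory.cond_isProbabilityMeasure_of_finite
      (measure_closedBall_pos _ _ one_pos).ne' measure_closedBall_lt_top.ne
  have h1 := hasGradientAt_uniformSmoothing hd one_pos
    (h := fun v => inner ℝ w v) (by fun_prop) 0
  have hballint : Integrable (fun v => inner ℝ w v) (uniformBall d) := by
    refine Integrable.smul_measure ?_ (by simp [(measure_closedBall_pos _ _ one_pos).ne'])
    exact (by fun_prop : Continuous fun v : EuclideanSpace ℝ (Fin d) =>
      inner ℝ w v).continuousOn.integrableOn_compact (isCompact_closedBall _ _)
  -- The additive constant need not be evaluated, since it does not affect the gradient.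
  have h2 : uniformSmoothing 1 (fun v => inner ℝ w v) =
      fun y => inner ℝ w y + ∫ v, inner ℝ w v ∂uniformBall d := by
    ext y
    simp only [uniformSmoothing, one_smul, inner_add_right]
    rw [integral_add (integrable_const _) hballint]
    simp
  have h3 : HasGradientAt (uniformSmoothing 1 (fun v => inner ℝ w v)) w 0 := by
    rw [h2, hasGradientAt_iff_hasFDerivAt]
    exact ((innerSL ℝ w).hasFDerivAt).add_const _
  have h4 := congrArg (inner ℝ w) (h1.unique h3)
  have hint : Integrable (fun u : sphere (0 : EuclideanSpace ℝ (Fin d)) 1 =>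
      inner ℝ w (u : EuclideanSpace ℝ (Fin d)) • (u : EuclideanSpace ℝ (Fin d)))
      (uniformSphere d) :=
    Continuous.integrable_of_hasCompactSupport (by fun_prop) (HasCompactSupport.of_compactSpace _)
  have hd' : (d : ℝ) ≠ 0 := by positivity
  simp only [zero_add, one_smul, div_one] at h4
  rw [inner_smul_right, ← integral_inner hint, real_inner_self_eq_norm_sq] at h4
  simp only [inner_smul_right, ← sq] at h4
  rw [← h4, mul_div_cancel_left₀ _ hd']

theorem norm_sq_integral_smul_uniformSphere_le {d : ℕ} (hd : 0 < d)
    {c : sphere (0 : EuclideanSpace ℝ (Fin d)) 1 → ℝ} (hc : Measurable c) {M : ℝ}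
    (hM : ∀ u, |c u| ≤ M) :
    ‖∫ u, c u • (u : EuclideanSpace ℝ (Fin d)) ∂uniformSphere d‖ ^ 2 ≤ M ^ 2 / d := by
  have := isProbabilityMeasure_uniformSphere hd
  have hd' : (0 : ℝ) < d := by positivity
  set w := ∫ u, c u • (u : EuclideanSpace ℝ (Fin d)) ∂uniformSphere d with hw
  have hint : Integrable (fun u => c u • (u : EuclideanSpace ℝ (Fin d))) (uniformSphere d) := by
    refine Integrable.of_bound (C := M) (by fun_prop) (.of_forall fun u => ?_)
    simpa [norm_smul] using hM u
  have h1 : ∫ u, c u * inner ℝ w (u : EuclideanSpace ℝ (Fin d)) ∂uniformSphere d = ‖w‖ ^ 2 := by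
    rw [← real_inner_self_eq_norm_sq, hw, ← integral_inner hint, ← hw]
    simp only [inner_smul_right]
  have i1 : Integrable (fun u => c u * inner ℝ w (u : EuclideanSpace ℝ (Fin d)))
      (uniformSphere d) := by
    simpa only [inner_smul_right] using hint.const_inner (𝕜 := ℝ) w
  have i2 : Integrable (fun u : sphere (0 : EuclideanSpace ℝ (Fin d)) 1 =>
      inner ℝ w (u : EuclideanSpace ℝ (Fin d)) ^ 2) (uniformSphere d) :=
    Continuous.integrable_of_hasCompactSupport (by fun_prop) (HasCompactSupport.of_compactSpace _)
  -- Integrates `2dc⟪w,u⟫ - d²⟪w,u⟫² ≤ c²`, that is `(c - d⟪w,u⟫)² ≥ 0`. The left side integrates to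
  -- `2d‖w‖² - d‖w‖² = d‖w‖²`.
  have h2 : ∫ u, (2 * d * (c u * inner ℝ w (u : EuclideanSpace ℝ (Fin d)))
      - d ^ 2 * inner ℝ w (u : EuclideanSpace ℝ (Fin d)) ^ 2) ∂uniformSphere d ≤ M ^ 2 := by
    have h3 : ∫ _ : sphere (0 : EuclideanSpace ℝ (Fin d)) 1, M ^ 2 ∂uniformSphere d = M ^ 2 := by
      simp
    rw [← h3]
    refine integral_mono ((i1.const_mul _).sub (i2.const_mul _)) (integrable_const _) fun u => ?_
    have h4 : c u ^ 2 ≤ M ^ 2 := sq_le_sq' (by linarith [abs_le.1 (hM u)]) (abs_le.1 (hM u)).2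
    simp only
    nlinarith [sq_nonneg (c u - d * inner ℝ w (u : EuclideanSpace ℝ (Fin d)))]
  rw [integral_sub (i1.const_mul _) (i2.const_mul _), integral_const_mul, integral_const_mul, h1,
    integral_inner_sq_uniformSphere hd] at h2
  rw [le_div_iff₀ hd']
  have h5 : (d : ℝ) ^ 2 * (‖w‖ ^ 2 / d) = d * ‖w‖ ^ 2 := by field_simp
  linarith

end UniformSphere

/-! ### Mean and variance of sample means. -/

section SampleMean

theorem integrable_norm_sq_of_bound {Ω E : Type*} [MeasurableSpace Ω] [NormedAddCommGroup E]
    [MeasurableSpace E] [OpensMeasurableSpace E] (ν : Measure Ω) [IsFiniteMeasure ν] {g : Ω → E}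
    (hg : Measurable g) {C : ℝ} (hC : ∀ ω, ‖g ω‖ ≤ C) : Integrable (fun ω => ‖g ω‖ ^ 2) ν :=
  Integrable.of_bound (C := C ^ 2) (hg.norm.pow_const 2).aestronglyMeasurable (.of_forall fun ω => by
    rw [Real.norm_of_nonneg (by positivity)]
    exact pow_le_pow_left₀ (norm_nonneg _) (hC ω) 2)

theorem integral_comp_of_measurePreserving {Ω Ω' G : Type*} [MeasurableSpace Ω]
    [MeasurableSpace Ω'] [NormedAddCommGroup G] [NormedSpace ℝ G] {μ : Measure Ω}
    {ν : Measure Ω'} {φ : Ω → Ω'} (hφ : MeasurePreserving φ μ ν) {k : Ω' → G}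
    (hk : AEStronglyMeasurable k ν) : ∫ ω, k (φ ω) ∂μ = ∫ ω, k ω ∂ν := by
  have := integral_map hφ.measurable.aemeasurable (f := k) (by rwa [hφ.map_eq])
  rw [hφ.map_eq] at this
  exact this.symm

theorem integrable_sampleMean {Ω E : Type*} [MeasurableSpace Ω] [NormedAddCommGroup E]
    [NormedSpace ℝ E] (ν : Measure Ω) [IsProbabilityMeasure ν] {n : ℕ}
    {g : Ω → E} (hg : Integrable g ν) :
    Integrable (fun ω : Fin n → Ω => (1 / (n : ℝ)) • ∑ i, g (ω i))
      (Measure.pi fun _ : Fin n => ν) :=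
  (integrable_finsetSum _ fun i _ => (measurePreserving_eval (fun _ : Fin n => ν)
    i).integrable_comp_of_integrable hg).smul _

theorem integral_sampleMean {Ω E : Type*} [MeasurableSpace Ω] [NormedAddCommGroup E]
    [NormedSpace ℝ E] (ν : Measure Ω) [IsProbabilityMeasure ν] {n : ℕ} (hn : 0 < n)
    {g : Ω → E} (hg : Integrable g ν) :
    ∫ ω, (1 / (n : ℝ)) • ∑ i, g (ω i) ∂(Measure.pi fun _ : Fin n => ν) = ∫ ω, g ω ∂ν := by
  have hn' : (n : ℝ) ≠ 0 := by positivity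
  have heval (i : Fin n) := measurePreserving_eval (fun _ : Fin n => ν) i
  have h1 (i : Fin n) : ∫ ω, g (ω i) ∂(Measure.pi fun _ : Fin n => ν) = ∫ ω, g ω ∂ν :=
    integral_comp_of_measurePreserving (heval i) hg.aestronglyMeasurable
  have h2 (i : Fin n) : Integrable (fun ω => g (ω i)) (Measure.pi fun _ : Fin n => ν) :=
    (heval i).integrable_comp_of_integrable hg
  rw [integral_smul, integral_finsetSum _ fun i _ => h2 i]
  simp only [h1, Finset.sum_const, Finset.card_univ, Fintype.card_fin,
    ← Nat.cast_smul_eq_nsmul ℝ, smul_smul]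
  rw [one_div_mul_cancel hn', one_smul]

variable {Ω E : Type*} [MeasurableSpace Ω] [NormedAddCommGroup E] [InnerProductSpace ℝ E]
  [CompleteSpace E] [MeasurableSpace E] [BorelSpace E] [SecondCountableTopology E]
  (ν : Measure Ω) [IsProbabilityMeasure ν]

theorem integral_norm_sub_integral_sq {g : Ω → E} (hg : Measurable g) {C : ℝ}
    (hC : ∀ ω, ‖g ω‖ ≤ C) :
    ∫ ω, ‖g ω - ∫ ω', g ω' ∂ν‖ ^ 2 ∂ν = ∫ ω, ‖g ω‖ ^ 2 ∂ν - ‖∫ ω, g ω ∂ν‖ ^ 2 := by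
  have hint : Integrable g ν := Integrable.of_bound hg.aestronglyMeasurable C (.of_forall hC)
  set m := ∫ ω, g ω ∂ν with hm
  have h1 (ω : Ω) : ‖g ω - m‖ ^ 2 = ‖g ω‖ ^ 2 - 2 * inner ℝ m (g ω) + ‖m‖ ^ 2 := by
    rw [norm_sub_sq_real, real_inner_comm]
  have i1 := integrable_norm_sq_of_bound ν hg hC
  have i2 : Integrable (fun ω => 2 * inner ℝ m (g ω)) ν := (hint.const_inner m).const_mul 2
  simp only [h1]
  rw [integral_add (f := fun ω => ‖g ω‖ ^ 2 - 2 * inner ℝ m (g ω)) (i1.sub i2)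
    (integrable_const _), integral_sub i1 i2, integral_const_mul,
    integral_inner hint, ← hm, real_inner_self_eq_norm_sq]
  simp
  ring

/-- The variance of the mean of `n` independent copies of a bounded random vector. -/
theorem integral_norm_sampleMean_sub_sq {n : ℕ} (hn : 0 < n) {g : Ω → E} (hg : Measurable g)
    {C : ℝ} (hC : ∀ ω, ‖g ω‖ ≤ C) :
    ∫ ω, ‖(1 / (n : ℝ)) • ∑ i, g (ω i) - ∫ ω', g ω' ∂ν‖ ^ 2 ∂(Measure.pi fun _ : Fin n => ν) =
      1 / n * ∫ ω, ‖g ω - ∫ ω', g ω' ∂ν‖ ^ 2 ∂ν := by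
  have hint : Integrable g ν := Integrable.of_bound hg.aestronglyMeasurable C (.of_forall hC)
  have hn' : (n : ℝ) ≠ 0 := by positivity
  set m := ∫ ω, g ω ∂ν with hm
  set a : Ω → E := fun ω => g ω - m with ha_def
  have ha : Measurable a := hg.sub_const m
  have haint : Integrable a ν := hint.sub (integrable_const m)
  have ha0 : ∫ ω, a ω ∂ν = 0 := by
    rw [ha_def, integral_sub hint (integrable_const m), ← hm]
    simp
  have haC (ω : Ω) : ‖a ω‖ ≤ C + ‖m‖ :=
    (norm_sub_le _ _).trans (by gcongr; exact hC ω)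
  have heval (i : Fin n) := measurePreserving_eval (fun _ : Fin n => ν) i
  have hindep : ProbabilityTheory.iIndepFun (fun (i : Fin n) ω => a (ω i))
      (Measure.pi fun _ : Fin n => ν) :=
    ProbabilityTheory.iIndepFun_pi fun _ => ha.aemeasurable
  have haint' (i : Fin n) : Integrable (fun ω => a (ω i)) (Measure.pi fun _ : Fin n => ν) :=
    (heval i).integrable_comp_of_integrable haint
  have hcross (i j : Fin n) : ∫ ω, inner ℝ (a (ω i)) (a (ω j)) ∂(Measure.pi fun _ : Fin n => ν) =
      if i = j then ∫ ω, ‖a ω‖ ^ 2 ∂ν else 0 := by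
    split_ifs with hij
    · subst hij
      simp only [real_inner_self_eq_norm_sq]
      exact integral_comp_of_measurePreserving (heval i) (k := fun ω => ‖a ω‖ ^ 2) (by fun_prop)
    -- By independence the expected inner product is the inner product of the means, which vanish.
    · refine ((hindep.indepFun hij).integral_bilin (haint' i) (haint' j) (innerSL ℝ)).trans ?_
      rw [integral_comp_of_measurePreserving (heval i) ha.aestronglyMeasurable, ha0]
      simp
  have hcint (i j : Fin n) : Integrable (fun ω => inner ℝ (a (ω i)) (a (ω j)))
      (Measure.pi fun _ : Fin n => ν) :=
    Integrable.of_bound (C := (C + ‖m‖) * (C + ‖m‖)) (by fun_prop) (.of_forall fun ω =>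
      (norm_inner_le_norm _ _).trans (mul_le_mul (haC _) (haC _) (norm_nonneg _)
        ((norm_nonneg _).trans (haC (ω i)))))
  have hexp (ω : Fin n → Ω) : ‖(1 / (n : ℝ)) • ∑ i, g (ω i) - m‖ ^ 2 =
      (1 / (n : ℝ)) ^ 2 * ∑ i, ∑ j, inner ℝ (a (ω i)) (a (ω j)) := by
    have h1 : (1 / (n : ℝ)) • ∑ i, g (ω i) - m = (1 / (n : ℝ)) • ∑ i, a (ω i) := by
      simp only [ha_def, Finset.sum_sub_distrib, Finset.sum_const, Finset.card_univ,
        Fintype.card_fin, smul_sub, ← Nat.cast_smul_eq_nsmul ℝ, smul_smul]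
      rw [one_div_mul_cancel hn', one_smul]
    rw [h1, norm_smul, mul_pow, Real.norm_eq_abs, sq_abs, ← real_inner_self_eq_norm_sq, sum_inner]
    simp only [inner_sum]
  simp only [hexp]
  rw [integral_const_mul, integral_finsetSum _ fun i _ => integrable_finsetSum _ fun j _ =>
    hcint i j]
  simp only [integral_finsetSum _ fun j _ => hcint _ j, hcross, Finset.sum_ite_eq,
    Finset.mem_univ, if_true, Finset.sum_const, Finset.card_univ, Fintype.card_fin, nsmul_eq_mul]
  field_simp
  rfl

end SampleMean

/-! ### A jointly measurable version of the integrand. -/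

section Caratheodory

/-- A function that is Lipschitz in the first variable and a.e. strongly measurable in the second
one agrees, off a null set of the second variable, with a jointly measurable one. -/
theorem exists_measurable_uncurry_ae_eq {X 𝒵 : Type*} [MetricSpace X]
    [SecondCountableTopology X] [MeasurableSpace X] [BorelSpace X] [MeasurableSpace 𝒵]
    (P : Measure 𝒵) {f : X → 𝒵 → ℝ} {L : ℝ≥0} (hLip : ∀ z, LipschitzWith L (fun x => f x z))
    (hf : ∀ x, AEStronglyMeasurable (f x) P) :
    ∃ g : X → 𝒵 → ℝ, Measurable (Function.uncurry g) ∧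
      (∀ z, LipschitzWith L (fun x => g x z)) ∧ ∀ᵐ z ∂P, ∀ x, f x z = g x z := by
  cases isEmpty_or_nonempty X
  · exact ⟨f, measurable_of_empty _, hLip, .of_forall fun _ x => isEmptyElim x⟩
  have hae : ∀ᵐ z ∂P, ∀ n : ℕ, f (TopologicalSpace.denseSeq X n) z =
      (hf (TopologicalSpace.denseSeq X n)).mk _ z :=
    ae_all_iff.2 fun n => (hf _).ae_eq_mk
  obtain ⟨s, hs, hsm, hPs⟩ := Filter.Eventually.exists_measurable_mem hae
  have hlim (x : X) : ∃ k : ℕ → ℕ, Filter.Tendsto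
      (fun j => TopologicalSpace.denseSeq X (k j)) Filter.atTop (nhds x) := by
    obtain ⟨y, hy, hyx⟩ := mem_closure_iff_seq_limit.1 (TopologicalSpace.denseRange_denseSeq X x)
    choose k hk using hy
    exact ⟨k, by simpa only [hk] using hyx⟩
  -- On `s` the values along a dense sequence agree with measurable ones, and continuity extends
  -- this to all `x`. Zeroing off `s` keeps every slice Lipschitz.
  refine ⟨fun x => s.indicator (f x), ?_, fun z => ?_, ?_⟩
  · have hlip (z : 𝒵) : Continuous fun x => s.indicator (f x) z := by
      by_cases hz : z ∈ s
      · simpa [hz] using (hLip z).continuous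
      · simpa [hz] using continuous_const
    refine measurable_uncurry_of_continuous_of_measurable hlip fun x => ?_
    obtain ⟨k, hk⟩ := hlim x
    refine measurable_of_tendsto_metrizable (f := fun j =>
      s.indicator ((hf (TopologicalSpace.denseSeq X (k j))).mk _)) (fun j =>
      (hf _).stronglyMeasurable_mk.measurable.indicator hsm) (tendsto_pi_nhds.2 fun z => ?_)
    have := ((hlip z).tendsto x).comp hk
    refine this.congr fun j => ?_
    by_cases hz : z ∈ s
    · simp [hz, hPs z hz (k j)]
    · simp [hz]
  · by_cases hz : z ∈ s
    · simpa [hz] using hLip z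
    · simpa [hz] using LipschitzWith.const' (K := L) (0 : ℝ)
  · filter_upwards [hs] with z hz x
    simp [hz]

end Caratheodory

/-! ### Sensitivity and moments of the estimator. -/

section Estimator

open Metric Set

variable {d : ℕ} {𝒵 : Type*}

/-- The average of `c z (u j) • u j` over `d` directions `u j`. -/
noncomputable def directionAverage
    (c : 𝒵 → sphere (0 : EuclideanSpace ℝ (Fin d)) 1 → ℝ)
    (p : 𝒵 × (Fin d → sphere (0 : EuclideanSpace ℝ (Fin d)) 1)) : EuclideanSpace ℝ (Fin d) :=
  (1 / (d : ℝ)) • ∑ j, c p.1 (p.2 j) • (p.2 j : EuclideanSpace ℝ (Fin d))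

variable {c : 𝒵 → sphere (0 : EuclideanSpace ℝ (Fin d)) 1 → ℝ}

theorem norm_directionAverage_le (hd : 0 < d) {K : ℝ} (hK : ∀ z u, |c z u| ≤ K)
    (p : 𝒵 × (Fin d → sphere (0 : EuclideanSpace ℝ (Fin d)) 1)) :
    ‖directionAverage c p‖ ≤ K := by
  have hd' : (0 : ℝ) < d := by positivity
  have h1 : ‖∑ j, c p.1 (p.2 j) • (p.2 j : EuclideanSpace ℝ (Fin d))‖ ≤ d * K := by
    refine (norm_sum_le_of_le (f := fun j => c p.1 (p.2 j) • (p.2 j : EuclideanSpace ℝ (Fin d)))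
      (n := fun _ => K) _ fun j _ => ?_).trans (by simp)
    simpa [norm_smul] using hK p.1 (p.2 j)
  rw [directionAverage, norm_smul, Real.norm_of_nonneg (by positivity), one_div,
    inv_mul_le_iff₀ hd']
  exact h1

variable {b : ℕ} {f : EuclideanSpace ℝ (Fin d) → 𝒵 → ℝ} {L : ℝ≥0} {δ : ℝ}

/-- The common shift `v` cancels in the difference of the two arguments; this is why every bound
scales with `‖x - y‖`. -/
theorem abs_scaled_increment_le (hLip : ∀ z, LipschitzWith L (fun x => f x z)) (hδ : 0 < δ)
    (x y v : EuclideanSpace ℝ (Fin d)) (z : 𝒵) :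
    |(d : ℝ) / δ * (f (x + v) z - f (y + v) z)| ≤ d / δ * (L * ‖x - y‖) := by
  rw [abs_mul, abs_of_nonneg (by positivity)]
  gcongr
  simpa [dist_eq_norm] using (hLip z).dist_le_mul (x + v) (y + v)

theorem norm_diffEstimator_sub_le (hd : 0 < d) (hLip : ∀ z, LipschitzWith L (fun x => f x z))
    (hδ : 0 < δ) (x y : EuclideanSpace ℝ (Fin d))
    (u : Fin b → Fin d → sphere (0 : EuclideanSpace ℝ (Fin d)) 1) {z z' : Fin b → 𝒵}
    (hz : Neighboring z z') :
    ‖diffEstimator f δ x y z u - diffEstimator f δ x y z' u‖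
      ≤ 2 * (d : ℝ) * (L : ℝ) * ‖x - y‖ / ((b : ℝ) * δ) := by
  obtain ⟨k, hk⟩ := hz
  set c : 𝒵 → sphere (0 : EuclideanSpace ℝ (Fin d)) 1 → ℝ := fun z u =>
    (d : ℝ) / δ * (f (x + δ • (u : EuclideanSpace ℝ (Fin d))) z
      - f (y + δ • (u : EuclideanSpace ℝ (Fin d))) z) with hc_def
  have hK (z : 𝒵) (u : sphere (0 : EuclideanSpace ℝ (Fin d)) 1) :
      |c z u| ≤ d / δ * (L * ‖x - y‖) :=
    abs_scaled_increment_le hLip hδ x y _ z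
  have hest (z : Fin b → 𝒵) : diffEstimator f δ x y z u =
      (1 / (b : ℝ)) • ∑ i, directionAverage c (z i, u i) := rfl
  have hsum : ∑ i, (directionAverage c (z i, u i) - directionAverage c (z' i, u i)) =
      directionAverage c (z k, u k) - directionAverage c (z' k, u k) :=
    Finset.sum_eq_single k (fun i _ hi => by rw [hk i hi, sub_self]) (by simp)
  rw [hest, hest, ← smul_sub, ← Finset.sum_sub_distrib, hsum, norm_smul,
    Real.norm_of_nonneg (by positivity)]
  calc 1 / (b : ℝ) * ‖directionAverage c (z k, u k) - directionAverage c (z' k, u k)‖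
      ≤ 1 / b * (d / δ * (L * ‖x - y‖) + d / δ * (L * ‖x - y‖)) := by
        gcongr
        exact (norm_sub_le _ _).trans (add_le_add (norm_directionAverage_le hd hK _)
          (norm_directionAverage_le hd hK _))
    _ = _ := by ring

variable [MeasurableSpace 𝒵]

theorem measurable_directionAverage (hc : Measurable (Function.uncurry c)) :
    Measurable (directionAverage c) := by
  unfold directionAverage
  have h (j : Fin d) : Measurable fun p : 𝒵 × (Fin d → sphere (0 : EuclideanSpace ℝ (Fin d)) 1) =>
      c p.1 (p.2 j) :=
    hc.comp (by fun_prop : Measurable fun p : 𝒵 × (Fin d → sphere (0 : EuclideanSpace ℝ (Fin d)) 1) =>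
      (p.1, p.2 j))
  fun_prop

theorem integral_directionAverage (hd : 0 < d) (P : Measure 𝒵) [IsProbabilityMeasure P]
    (hc : Measurable (Function.uncurry c)) {K : ℝ} (hK : ∀ z u, |c z u| ≤ K) :
    ∫ p, directionAverage c p ∂(P.prod (Measure.pi fun _ => uniformSphere d)) =
      ∫ u, (∫ z, c z u ∂P) • (u : EuclideanSpace ℝ (Fin d)) ∂uniformSphere d := by
  have := isProbabilityMeasure_uniformSphere hd
  have hint : Integrable (directionAverage c) (P.prod (Measure.pi fun _ => uniformSphere d)) :=
    Integrable.of_bound (measurable_directionAverage hc).aestronglyMeasurable K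
      (.of_forall (norm_directionAverage_le hd hK))
  have hcu : Integrable (fun p : 𝒵 × sphere (0 : EuclideanSpace ℝ (Fin d)) 1 =>
      c p.1 p.2 • (p.2 : EuclideanSpace ℝ (Fin d))) (P.prod (uniformSphere d)) := by
    have h1 : Measurable fun p : 𝒵 × sphere (0 : EuclideanSpace ℝ (Fin d)) 1 => c p.1 p.2 := hc
    refine Integrable.of_bound (by fun_prop) K (.of_forall fun p => ?_)
    simpa [norm_smul] using hK p.1 p.2
  have hz (z : 𝒵) : Integrable (fun u => c z u • (u : EuclideanSpace ℝ (Fin d)))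
      (uniformSphere d) := by
    have h1 : Measurable (c z) := hc.comp measurable_prodMk_left
    refine Integrable.of_bound (by fun_prop) K (.of_forall fun u => ?_)
    simpa [norm_smul] using hK z u
  rw [integral_prod _ hint]
  simp only [directionAverage, integral_sampleMean _ hd (hz _)]
  rw [integral_integral_swap hcu]
  simp only [integral_smul_const]

/-- For fixed `z`, the second moment is variance plus squared mean. Independence of the `d`
directions bounds the first by `K²/d`, and `norm_sq_integral_smul_uniformSphere_le` bounds the
second by the same amount. -/
theorem integral_norm_directionAverage_sq_le (hd : 0 < d) (P : Measure 𝒵) [IsProbabilityMeasure P]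
    (hc : Measurable (Function.uncurry c)) {K : ℝ} (hK : ∀ z u, |c z u| ≤ K) :
    ∫ p, ‖directionAverage c p‖ ^ 2 ∂(P.prod (Measure.pi fun _ => uniformSphere d)) ≤
      2 * K ^ 2 / d := by
  have := isProbabilityMeasure_uniformSphere hd
  have hd' : (0 : ℝ) < d := by positivity
  have hint := integrable_norm_sq_of_bound (P.prod (Measure.pi fun _ => uniformSphere d))
    (measurable_directionAverage hc) (norm_directionAverage_le hd hK)
  rw [integral_prod _ hint]
  refine (integral_mono hint.integral_prod_left (integrable_const (2 * K ^ 2 / d))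
    fun z => ?_).trans (by simp)
  have hcz : Measurable (c z) := hc.comp measurable_prodMk_left
  have hψ : Measurable fun u => c z u • (u : EuclideanSpace ℝ (Fin d)) := by fun_prop
  have hψK (u : sphere (0 : EuclideanSpace ℝ (Fin d)) 1) :
      ‖c z u • (u : EuclideanSpace ℝ (Fin d))‖ ≤ K := by
    simpa [norm_smul] using hK z u
  have hψint : Integrable (fun u => c z u • (u : EuclideanSpace ℝ (Fin d))) (uniformSphere d) :=
    Integrable.of_bound hψ.aestronglyMeasurable K (.of_forall hψK)
  have h1 := integral_norm_sub_integral_sq (Measure.pi fun _ => uniformSphere d)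
    ((measurable_directionAverage hc).comp (measurable_prodMk_left (x := z)))
    (fun u => norm_directionAverage_le hd hK (z, u))
  have h2 := integral_norm_sampleMean_sub_sq (uniformSphere d) hd hψ hψK
  have h3 := integral_norm_sub_integral_sq (uniformSphere d) hψ hψK
  have h4 := norm_sq_integral_smul_uniformSphere_le hd hcz (hK z)
  have h5 : ∫ u, ‖c z u • (u : EuclideanSpace ℝ (Fin d))‖ ^ 2 ∂uniformSphere d ≤ K ^ 2 := by
    refine (integral_mono (integrable_norm_sq_of_bound _ hψ hψK) (integrable_const (K ^ 2))
      fun u => ?_).trans (by simp)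
    exact pow_le_pow_left₀ (norm_nonneg _) (hψK u) 2
  have h6 := integral_sampleMean (uniformSphere d) hd hψint
  simp only [Function.comp_apply, directionAverage] at h1
  rw [h6, h2, h3] at h1
  simp only [directionAverage]
  have h7 : 1 / (d : ℝ) * (∫ u, ‖c z u • (u : EuclideanSpace ℝ (Fin d))‖ ^ 2 ∂uniformSphere d -
      ‖∫ u, c z u • (u : EuclideanSpace ℝ (Fin d)) ∂uniformSphere d‖ ^ 2) ≤ 1 / d * K ^ 2 := by
    gcongr
    linarith [sq_nonneg ‖∫ u, c z u • (u : EuclideanSpace ℝ (Fin d)) ∂uniformSphere d‖]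
  have h8 : 2 * K ^ 2 / d = 1 / d * K ^ 2 + K ^ 2 / d := by ring
  linarith

theorem lipschitzWith_objective (P : Measure 𝒵) [IsProbabilityMeasure P]
    (hLip : ∀ z, LipschitzWith L (fun x => f x z)) (hint : ∀ x, Integrable (f x) P) :
    LipschitzWith L (objective P f) := by
  refine LipschitzWith.of_dist_le_mul fun x y => ?_
  rw [Real.dist_eq, objective, objective, ← integral_sub (hint x) (hint y)]
  have h (z : 𝒵) : ‖f x z - f y z‖ ≤ L * dist x y := by
    simpa [dist_eq_norm] using (hLip z).dist_le_mul x y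
  exact (norm_integral_le_of_norm_le_const (.of_forall h)).trans (by simp)

theorem hasGradientAt_uniformSmoothing_objective (hd : 0 < d) (P : Measure 𝒵)
    [IsProbabilityMeasure P] (hLip : ∀ z, LipschitzWith L (fun x => f x z))
    (hint : ∀ x, Integrable (f x) P) (hδ : 0 < δ) (x : EuclideanSpace ℝ (Fin d)) :
    HasGradientAt (uniformSmoothing δ (objective P f))
      (((d : ℝ) / δ) • ∫ u : sphere (0 : EuclideanSpace ℝ (Fin d)) 1,
        objective P f (x + δ • (u : EuclideanSpace ℝ (Fin d))) • (u : EuclideanSpace ℝ (Fin d))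
          ∂uniformSphere d) x :=
  hasGradientAt_uniformSmoothing hd hδ (lipschitzWith_objective P hLip hint).continuous x

theorem gradient_uniformSmoothing_objective_sub (hd : 0 < d) (P : Measure 𝒵)
    [IsProbabilityMeasure P] (hLip : ∀ z, LipschitzWith L (fun x => f x z))
    (hint : ∀ x, Integrable (f x) P) (hδ : 0 < δ) (x y : EuclideanSpace ℝ (Fin d)) :
    gradient (uniformSmoothing δ (objective P f)) x
        - gradient (uniformSmoothing δ (objective P f)) y =
      ∫ u : sphere (0 : EuclideanSpace ℝ (Fin d)) 1,
        (∫ z, (d : ℝ) / δ * (f (x + δ • (u : EuclideanSpace ℝ (Fin d))) z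
          - f (y + δ • (u : EuclideanSpace ℝ (Fin d))) z) ∂P) • (u : EuclideanSpace ℝ (Fin d))
          ∂uniformSphere d := by
  have := isProbabilityMeasure_uniformSphere hd
  have hF := (lipschitzWith_objective P hLip hint).continuous
  have hi (x : EuclideanSpace ℝ (Fin d)) :
      Integrable (fun u : sphere (0 : EuclideanSpace ℝ (Fin d)) 1 =>
        objective P f (x + δ • (u : EuclideanSpace ℝ (Fin d))) • (u : EuclideanSpace ℝ (Fin d)))
        (uniformSphere d) :=
    Continuous.integrable_of_hasCompactSupport (by fun_prop) (HasCompactSupport.of_compactSpace _)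
  rw [(hasGradientAt_uniformSmoothing_objective hd P hLip hint hδ x).gradient,
    (hasGradientAt_uniformSmoothing_objective hd P hLip hint hδ y).gradient, ← smul_sub,
    ← integral_sub (hi x) (hi y), ← integral_smul]
  simp only [integral_const_mul, integral_sub (hint _) (hint _), objective, ← sub_smul, smul_smul]

theorem diffEstimator_moments (hd : 0 < d) (hb : 0 < b) (P : Measure 𝒵) [IsProbabilityMeasure P]
    (hf : Measurable (Function.uncurry f)) (hLip : ∀ z, LipschitzWith L (fun x => f x z))
    (hδ : 0 < δ) (x y : EuclideanSpace ℝ (Fin d)) {m : EuclideanSpace ℝ (Fin d)}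
    (hm : m = ∫ u : sphere (0 : EuclideanSpace ℝ (Fin d)) 1,
        (∫ z, (d : ℝ) / δ * (f (x + δ • (u : EuclideanSpace ℝ (Fin d))) z
          - f (y + δ • (u : EuclideanSpace ℝ (Fin d))) z) ∂P) • (u : EuclideanSpace ℝ (Fin d))
          ∂uniformSphere d) :
    (Integrable (fun ω => diffEstimator f δ x y ω.1 ω.2) (estimatorLaw d b P) ∧
      ∫ ω, diffEstimator f δ x y ω.1 ω.2 ∂(estimatorLaw d b P) = m) ∧
    (Integrable (fun ω => ‖diffEstimator f δ x y ω.1 ω.2 - m‖ ^ 2) (estimatorLaw d b P) ∧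
      ∫ ω, ‖diffEstimator f δ x y ω.1 ω.2 - m‖ ^ 2 ∂(estimatorLaw d b P)
        ≤ 2 * (d : ℝ) * (L : ℝ) ^ 2 * ‖x - y‖ ^ 2 / ((b : ℝ) * δ ^ 2)) := by
  have := isProbabilityMeasure_uniformSphere hd
  set c : 𝒵 → sphere (0 : EuclideanSpace ℝ (Fin d)) 1 → ℝ := fun z u =>
    (d : ℝ) / δ * (f (x + δ • (u : EuclideanSpace ℝ (Fin d))) z
      - f (y + δ • (u : EuclideanSpace ℝ (Fin d))) z) with hc_def
  set K : ℝ := d / δ * (L * ‖x - y‖) with hK_def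
  have hK (z : 𝒵) (u : sphere (0 : EuclideanSpace ℝ (Fin d)) 1) : |c z u| ≤ K :=
    abs_scaled_increment_le hLip hδ x y _ z
  have hc : Measurable (Function.uncurry c) := by
    have h1 (x : EuclideanSpace ℝ (Fin d)) :
        Measurable fun p : 𝒵 × sphere (0 : EuclideanSpace ℝ (Fin d)) 1 =>
          f (x + δ • (p.2 : EuclideanSpace ℝ (Fin d))) p.1 :=
      hf.comp (by fun_prop : Measurable fun p : 𝒵 × sphere (0 : EuclideanSpace ℝ (Fin d)) 1 =>
        (x + δ • (p.2 : EuclideanSpace ℝ (Fin d)), p.1))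
    exact ((h1 x).sub (h1 y)).const_mul _
  set ν := P.prod (Measure.pi fun _ : Fin d => uniformSphere d) with hν
  have hg := measurable_directionAverage hc
  have hgK := norm_directionAverage_le hd hK
  have hgint : Integrable (directionAverage c) ν :=
    Integrable.of_bound hg.aestronglyMeasurable K (.of_forall hgK)
  have hmean : ∫ p, directionAverage c p ∂ν = m := by
    rw [hm, hν, integral_directionAverage hd P hc hK]
  -- Regrouping pairs each data point with its own directions, making the estimator a sample mean of
  -- `b` i.i.d. blocks.
  set e := MeasurableEquiv.arrowProdEquivProdArrow 𝒵
    (Fin d → sphere (0 : EuclideanSpace ℝ (Fin d)) 1) (Fin b) with he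
  have hmp : MeasurePreserving e (Measure.pi fun _ => ν) (estimatorLaw d b P) :=
    measurePreserving_arrowProdEquivProdArrow 𝒵
      (Fin d → sphere (0 : EuclideanSpace ℝ (Fin d)) 1) (Fin b) (fun _ => P)
      (fun _ => Measure.pi fun _ => uniformSphere d)
  have hest (ω : Fin b → 𝒵 × (Fin d → sphere (0 : EuclideanSpace ℝ (Fin d)) 1)) :
      diffEstimator f δ x y (e ω).1 (e ω).2 = (1 / (b : ℝ)) • ∑ i, directionAverage c (ω i) := rfl
  have hsq : Integrable (fun ω : Fin b → 𝒵 × (Fin d → sphere (0 : EuclideanSpace ℝ (Fin d)) 1) =>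
      ‖(1 / (b : ℝ)) • ∑ i, directionAverage c (ω i) - m‖ ^ 2) (Measure.pi fun _ => ν) := by
    refine integrable_norm_sq_of_bound (C := K + ‖m‖) _ (by fun_prop) fun ω => ?_
    refine (norm_sub_le _ _).trans (add_le_add_left ?_ _)
    have hb' : (0 : ℝ) < b := by positivity
    rw [norm_smul, Real.norm_of_nonneg (by positivity), one_div, inv_mul_le_iff₀ hb']
    exact (norm_sum_le_of_le _ fun i _ => hgK (ω i)).trans (by simp)
  refine ⟨⟨?_, ?_⟩, ?_, ?_⟩
  · rw [← hmp.integrable_comp_emb e.measurableEmbedding, Function.comp_def]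
    simp only [hest]
    exact integrable_sampleMean (n := b) ν hgint
  · rw [← hmp.integral_comp e.measurableEmbedding]
    simp only [hest]
    rw [integral_sampleMean ν hb hgint, hmean]
  · rw [← hmp.integrable_comp_emb e.measurableEmbedding, Function.comp_def]
    simp only [hest]
    exact hsq
  · rw [← hmp.integral_comp e.measurableEmbedding]
    simp only [hest]
    rw [← hmean, integral_norm_sampleMean_sub_sq ν hb hg hgK,
      integral_norm_sub_integral_sq ν hg hgK]
    have h1 := integral_norm_directionAverage_sq_le hd P hc hK
    calc 1 / (b : ℝ) * (∫ ω, ‖directionAverage c ω‖ ^ 2 ∂ν - ‖∫ ω, directionAverage c ω ∂ν‖ ^ 2)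
        ≤ 1 / b * (2 * K ^ 2 / d) := by
          gcongr
          linarith [sq_nonneg ‖∫ ω, directionAverage c ω ∂ν‖]
      _ = _ := by
          rw [hK_def]
          have : (d : ℝ) ≠ 0 := by positivity
          field_simp

/-- The null set must be independent of `x`, since the evaluation points depend on the random
directions. -/
theorem diffEstimator_congr_ae (hd : 0 < d) (P : Measure 𝒵) [IsProbabilityMeasure P]
    {g : EuclideanSpace ℝ (Fin d) → 𝒵 → ℝ} (hfg : ∀ᵐ z ∂P, ∀ x, f x z = g x z)
    (x y : EuclideanSpace ℝ (Fin d)) :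
    (fun ω => diffEstimator f δ x y ω.1 ω.2) =ᵐ[estimatorLaw d b P]
      fun ω => diffEstimator g δ x y ω.1 ω.2 := by
  have := isProbabilityMeasure_uniformSphere hd
  have h1 : ∀ᵐ z ∂(Measure.pi fun _ : Fin b => P), ∀ i, ∀ x, f x (z i) = g x (z i) :=
    ae_all_iff.2 fun i => (measurePreserving_eval (fun _ : Fin b => P) i).quasiMeasurePreserving.ae hfg
  have h2 : ∀ᵐ ω ∂estimatorLaw d b P, ∀ i, ∀ x, f x (ω.1 i) = g x (ω.1 i) :=
    Measure.quasiMeasurePreserving_fst.ae h1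
  filter_upwards [h2] with ω hω
  simp only [diffEstimator, hω]

end Estimator

/-! ### Transfer from the measurable version back to `f`. -/

theorem mainTheorem6 {d b : ℕ} (hd : 0 < d) (hb : 0 < b)
    {𝒵 : Type*} [MeasurableSpace 𝒵] (P : Measure 𝒵) [IsProbabilityMeasure P]
    (f : EuclideanSpace ℝ (Fin d) → 𝒵 → ℝ) (L : ℝ≥0)
    (hLip : ∀ z, LipschitzWith L (fun x => f x z))
    (hint : ∀ x, Integrable (fun z => f x z) P)
    (δ : ℝ) (hδ : 0 < δ) (x y : EuclideanSpace ℝ (Fin d)) :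
    -- the smoothed objective is differentiable, so that its gradients are meaningful
    Differentiable ℝ (uniformSmoothing δ (objective P f)) ∧
    -- unbiasedness
    (Integrable (fun ω => diffEstimator f δ x y ω.1 ω.2) (estimatorLaw d b P) ∧
      ∫ ω, diffEstimator f δ x y ω.1 ω.2 ∂(estimatorLaw d b P)
        = gradient (uniformSmoothing δ (objective P f)) x
          - gradient (uniformSmoothing δ (objective P f)) y) ∧
    -- variance
    (Integrable (fun ω => ‖diffEstimator f δ x y ω.1 ω.2
          - (gradient (uniformSmoothing δ (objective P f)) x
            - gradient (uniformSmoothing δ (objective P f)) y)‖ ^ 2) (estimatorLaw d b P) ∧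
      ∫ ω, ‖diffEstimator f δ x y ω.1 ω.2
          - (gradient (uniformSmoothing δ (objective P f)) x
            - gradient (uniformSmoothing δ (objective P f)) y)‖ ^ 2 ∂(estimatorLaw d b P)
        ≤ 16 * (d : ℝ) * (L : ℝ) ^ 2 * ‖x - y‖ ^ 2 / ((b : ℝ) * δ ^ 2)) ∧
    -- sensitivity, for every realization of the random directions
    (∀ (u : Fin b → Fin d → Metric.sphere (0 : EuclideanSpace ℝ (Fin d)) 1)
        (z z' : Fin b → 𝒵), Neighboring z z' →
      ‖diffEstimator f δ x y z u - diffEstimator f δ x y z' u‖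
        ≤ 2 * (d : ℝ) * (L : ℝ) * ‖x - y‖ / ((b : ℝ) * δ)) := by
  have hgrad := hasGradientAt_uniformSmoothing_objective hd P hLip hint hδ
  refine ⟨fun x => (hgrad x).differentiableAt, ?_⟩
  obtain ⟨g, hgm, hgLip, hfg⟩ := exists_measurable_uncurry_ae_eq P hLip
    fun x => (hint x).aestronglyMeasurable
  have hgint (x : EuclideanSpace ℝ (Fin d)) : Integrable (g x) P :=
    (hint x).congr (hfg.mono fun z hz => hz x)
  have hobj : objective P f = objective P g :=
    funext fun x => integral_congr_ae (hfg.mono fun z hz => hz x)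
  have hae := diffEstimator_congr_ae (b := b) (δ := δ) hd P hfg x y
  set m := gradient (uniformSmoothing δ (objective P f)) x
    - gradient (uniformSmoothing δ (objective P f)) y with hm
  have hsq : (fun ω => ‖diffEstimator f δ x y ω.1 ω.2 - m‖ ^ 2) =ᵐ[estimatorLaw d b P]
      fun ω => ‖diffEstimator g δ x y ω.1 ω.2 - m‖ ^ 2 :=
    hae.mono fun ω hω => by simp only [hω]
  obtain ⟨⟨h1, h2⟩, h3, h4⟩ := diffEstimator_moments (b := b) (m := m) hd hb P hgm hgLip hδ x y
    (by rw [hm, hobj, gradient_uniformSmoothing_objective_sub hd P hgLip hgint hδ])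
  refine ⟨⟨h1.congr hae.symm, (integral_congr_ae hae).trans h2⟩,
    ⟨h3.congr hsq.symm, (integral_congr_ae hsq).trans_le (h4.trans ?_)⟩,
    fun u z z' hz => norm_diffEstimator_sub_le hd hLip hδ x y u hz⟩
  -- What remains is `2 ≤ 16`.
  gcongr
  norm_num
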